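/- Let $\{0,1\}^*$ be the set of finite binary strings and $\{0,1\}^\infty$ the set of infinite binary sequences. For a string $w$ of length $|w|$ let $C_w$ be the set of all $Z\in\{0,1\}^\infty$ having $w$ as a prefix, and for $Z\in\{0,1\}^\infty$ let $Z\upharpoonright m$ be the string of its first $m$ bits. Let $\lambda$ be the uniform probability measure on $\{0,1\}^\infty$, so $\lambda(C_w)=2^{-|w|}$. A sequence $X\in\{0,1\}^\infty$ is Martin-Löf random if there is no computable function $g:\mathbb{N}\times\mathbb{N}\to\{0,1\}^*$ such that, for every $k\in\mathbb{N}$, $X\in\bigcup_{n=0}^\infty C_{g(k,n)}$ and $\sum_{n=0}^\infty\lambda(C_{g(k,n)})\le 2^{-k}$. A learning function is a function $l:\{0,1\}^*\to\{\mathrm{yes},\mathrm{no}\}$. It uniformly weakly detects that $X$ is patterned if $l(X\upharpoonright m)=\mathrm{yes}$ for infinitely many $m\in\mathbb{N}$ and, for all $n\in\mathbb{N}$, $$\lambda\bigl(\{Y\in\{0,1\}^\infty : \#\{m\in\mathbb{N} : l(Y\upharpoonright m)=\mathrm{yes}\}\ge n\}\bigr)\le 2^{-n}.$$ Then, for every $X\in\{0,1\}^\infty$: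 $X$ is Martin-Löf random if and only if there is no learning function, computable by a deterministic Turing machine in time polynomial in the length of its input, that uniformly weakly detects that $X$ is patterned. -/

import Mathlib

open MeasureTheory

/-- The Cantor space of infinite binary sequences, with the product σ-algebra. -/
abbrev Cantor : Type := ℕ → Bool

/-- `Z.take n` is the string formed by the first `n` bits of `Z`. -/
def Cantor.take (Z : Cantor) (n : ℕ) : List Bool :=
  (List.range n).map Z

/-- The cylinder of all sequences having `w` as a prefix. -/
def cylinderAt (w : List Bool) : Set Cantor :=
  {Z | Z.take w.length = w}

/-- The uniform (Lebesgue) probability measure on Cantor space: independent fair bits. -/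
noncomputable def cantorLebesgue : Measure Cantor :=
  Measure.infinitePi fun _ : ℕ => (PMF.uniformOfFintype Bool).toMeasure

/-- The uniform measure gives the cylinder at `w` the mass `2^(-|w|)`. -/
theorem cantorLebesgue_cylinderAt (w : List Bool) :
    cantorLebesgue (cylinderAt w) = (2 : ENNReal)⁻¹ ^ w.length := by
  have h : cylinderAt w
      = Set.pi (Finset.range w.length : Set ℕ) fun i => {w.getD i false} := by
    ext Z
    simp only [cylinderAt, Cantor.take, Set.mem_ofPred_eq, Set.mem_pi, Finset.coe_range,
      Set.mem_Iio, Set.mem_singleton_iff]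
    constructor
    · intro hZ i hi
      have := congrArg (fun l => l.getD i false) hZ
      simpa [List.getD, hi] using this
    · intro hZ
      apply List.ext_getElem
      · simp
      · intro i h1 h2
        have := hZ i h2
        simpa [List.getD, h2] using this
  rw [h, cantorLebesgue, Measure.infinitePi_pi]
  · simp
  · intro i _
    exact measurableSet_singleton _

/-- `A` has algorithmic `μ`-measure zero: a computable double sequence of strings gives, for each
`k`, a cover of `A` by cylinders of total mass at most `2^(-k)`. -/
def AlgorithmicMeasureZero (μ : Measure Cantor) (A : Set Cantor) : Prop :=
  ∃ g : ℕ → ℕ → List Bool, Computable₂ g ∧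
    ∀ k : ℕ, (A ⊆ ⋃ n, cylinderAt (g k n)) ∧
      ∑' n, μ (cylinderAt (g k n)) ≤ (2 : ENNReal)⁻¹ ^ k

/-- Martin-Löf randomness with respect to the uniform measure. -/
def MartinLofRandom (X : Cantor) : Prop :=
  ¬ AlgorithmicMeasureZero cantorLebesgue {X}

/-- Learning functions; the answers yes and no are `true` and `false`. -/
abbrev LearningFunction : Type := List Bool → Bool

/-- `l` uniformly weakly detects that `X` is patterned. -/
def UniformlyWeaklyDetects (l : LearningFunction) (X : Cantor) : Prop :=
  {m : ℕ | l (X.take m) = true}.Infinite ∧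
    ∀ n : ℕ, cantorLebesgue {Y : Cantor | (n : ℕ∞) ≤ {m : ℕ | l (Y.take m) = true}.encard}
      ≤ (2 : ENNReal)⁻¹ ^ n

/-- `l` is computed by a deterministic Turing machine (a multi-stack machine with finitely many
stacks, labels and internal states, and finite stack alphabets) which on every input `w` halts
with output `l w` after at most `p(|w|)` steps, for some polynomial `p`. The input is the
string `w` itself and the output is the single bit `l w`. -/
def PolyTimeComputable (l : LearningFunction) : Prop :=
  ∃ M : Turing.TM2ComputableInPolyTime (id : List Bool → List Bool) Computability.encodeBool l,
    ∀ k : M.tm.K, Finite (M.tm.Γ k)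

/-! Both directions convert tests into learners and back; the surprising part is that polynomial
time costs nothing.

From a learner `l` to a test: the strings at which `l` says yes for the `n`-th time have pairwise
disjoint cylinders, all inside the set of sequences with at least `n` yes answers, so their masses
sum to at most `2^(-n)`. A sequence with infinitely many yes answers meets every such family. These
families are enumerable because `l` is primitive recursive: a machine with finite control and finite
alphabets is simulated step by step up to its polynomial time bound (`PolyTimeComputable.primrec`).

From a test `g` to a computable learner (`testLearner`): keep a level, initially `0`, and say yes,
raising the level from `j` to `j + 1`, when a string of row `j + 1` listed so far is a prefix of the
data. At least `n` yes answers, for `n` positive, force membership in the cover of row `n`, and a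
sequence covered by all rows never stays at one level.

From a computable learner `L` to a polynomial time one: delay the answers. A fixed process reads the
data bit by bit and evaluates `L` on the successive prefixes; the new learner, given `w`, runs the
process for `|w|` steps and says yes iff the process is just then accepting. Along each sequence the
yes positions are moved by an injection (`setOf_delayedLearner`), so their number is unchanged and
detection is preserved. Running a fixed machine for `|w|` steps takes linear time
(`polyTimeComputable_label_iterate_next`). -/

section FiniteDomain

variable {α β γ : Type*} [Primcodable α] [Primcodable β] [Primcodable γ]

/-- A function of two variables, the first of which ranges over a finite type, is primitive
recursive as soon as all its sections are. -/
theorem Primrec₂.of_finite_left [Finite α] {f : α → β → γ} (hf : ∀ a, Primrec (f a)) :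
    Primrec₂ f := by
  classical
  obtain ⟨n, ⟨e⟩⟩ := Finite.exists_equiv_fin α
  have h : Primrec₂ fun (i : Fin n) b => f (e.symm i) b :=
    Primrec.fin_curry₁.2 fun i => hf (e.symm i)
  exact (h.comp ((Primrec.dom_finite e).comp Primrec.fst) Primrec.snd).of_eq fun p => by simp

end FiniteDomain

/-- Evaluation of a polynomial with natural coefficients is primitive recursive. -/
theorem Polynomial.primrec_eval_nat (p : Polynomial ℕ) : Primrec fun n => p.eval n := by
  induction p using Polynomial.induction_on' with
  | add p q hp hq => exact (Primrec.nat_add.comp hp hq).of_eq fun n => by simp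
  | monomial k a =>
    have hpow : Primrec fun n : ℕ => n ^ k := by
      induction k with
      | zero => exact (Primrec.const 1).of_eq fun n => by simp
      | succ k ih => exact (Primrec.nat_mul.comp ih Primrec.id).of_eq fun n => by simp [pow_succ]
    exact (Primrec.nat_mul.comp (Primrec.const a) hpow).of_eq fun n => by simp

theorem Primrec.fin_update {n : ℕ} {α : Type*} [Primcodable α] (i : Fin n) {f : (Fin n → α) → α}
    (hf : Primrec f) : Primrec fun S : Fin n → α => Function.update S i (f S) := by
  refine Primrec.fin_curry.2 ?_
  refine (Primrec.ite (c := fun p : (Fin n → α) × Fin n => p.2 = i)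
    (Primrec.eq.comp Primrec.snd (Primrec.const i)) (hf.comp Primrec.fst)
    (Primrec.fin_app.comp Primrec.fst Primrec.snd)).of_eq fun p => ?_
  simp [Function.update_apply]

/-! ### Primitive recursive simulation of multi-stack machines. -/

namespace Turing.TM2

section Coding

variable {K : Type} {Γ : K → Type} {Λ σ : Type} {n : ℕ} (ι : K ≃ Fin n) [∀ k, Primcodable (Γ k)]

/-- The stacks of a machine as a vector of lists of codes. -/
def codeStacks (S : ∀ k, List (Γ k)) : Fin n → List ℕ :=
  fun i => (S (ι.symm i)).map Encodable.encode

theorem codeStacks_apply (S : ∀ k, List (Γ k)) (k : K) :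
    codeStacks ι S (ι k) = (S k).map Encodable.encode := by
  have : ∀ k', k' = k → (S k').map Encodable.encode = (S k).map Encodable.encode := by
    rintro _ rfl; rfl
  exact this _ (by simp)

/-- A configuration with coded stacks. -/
def codeCfg (c : Cfg Γ Λ σ) : Option Λ × σ × (Fin n → List ℕ) :=
  (c.l, c.var, codeStacks ι c.stk)

theorem primrec_decodeHead (k : K) : Primrec fun S : Fin n → List ℕ =>
    ((S (ι k)).head?.bind fun x => (Encodable.decode x : Option (Γ k))) :=
  Primrec.option_bind
    (Primrec.list_head?.comp (Primrec.fin_app.comp Primrec.id (Primrec.const (ι k))))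
    (Primrec.decode.comp Primrec.snd)

theorem decodeHead_codeStacks (S : ∀ k, List (Γ k)) (k : K) :
    ((codeStacks ι S (ι k)).head?.bind fun x => (Encodable.decode x : Option (Γ k)))
      = (S k).head? := by
  rw [codeStacks_apply]
  cases S k <;> simp

end Coding

variable {K : Type} [DecidableEq K] {Γ : K → Type} {Λ σ : Type}

/-- One step of a machine, where halted configurations stay put. -/
def next (M : Λ → Stmt Γ Λ σ) (c : Cfg Γ Λ σ) : Cfg Γ Λ σ :=
  (step M c).getD c

theorem next_some (M : Λ → Stmt Γ Λ σ) (q : Λ) (v : σ) (S : ∀ k, List (Γ k)) :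
    next M ⟨some q, v, S⟩ = stepAux (M q) v S := rfl

theorem next_none (M : Λ → Stmt Γ Λ σ) (v : σ) (S : ∀ k, List (Γ k)) :
    next M ⟨none, v, S⟩ = ⟨none, v, S⟩ := rfl

theorem iterate_next_none (M : Λ → Stmt Γ Λ σ) (n : ℕ) (v : σ) (S : ∀ k, List (Γ k)) :
    (next M)^[n] ⟨none, v, S⟩ = ⟨none, v, S⟩ :=
  Function.iterate_fixed (next_none M v S) n

/-- Halted configurations are fixed by `next`, so the unknown halting time may be replaced by any
upper bound, such as the polynomial one. -/
theorem iterate_next_of_le {M : Λ → Stmt Γ Λ σ} {m n : ℕ} {a b : Cfg Γ Λ σ}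
    (h : (next M)^[m] a = b) (hb : b.l = none) (hmn : m ≤ n) : (next M)^[n] a = b := by
  obtain ⟨d, rfl⟩ := Nat.exists_eq_add_of_le' hmn
  rcases b with ⟨l, v, S⟩
  cases hb
  rw [Function.iterate_add_apply, h, iterate_next_none]

theorem bind_step_iterate_none (M : Λ → Stmt Γ Λ σ) (n : ℕ) :
    (flip bind (step M))^[n] none = none :=
  Function.iterate_fixed rfl n

theorem iterate_next_of_bind_step {M : Λ → Stmt Γ Λ σ} {n : ℕ} {a b : Cfg Γ Λ σ}
    (h : (flip bind (step M))^[n] (some a) = some b) : (next M)^[n] a = b := by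
  induction n generalizing a with
  | zero => simpa using h
  | succ n ih =>
    rw [Function.iterate_succ_apply] at h ⊢
    change (flip bind (step M))^[n] (step M a) = _ at h
    rcases hs : step M a with _ | a'
    · rw [hs, bind_step_iterate_none] at h
      cases h
    · rw [hs] at h
      rw [next, hs]
      exact ih h

section Primrec

variable {n : ℕ} (ι : K ≃ Fin n) [∀ k, Primcodable (Γ k)]

theorem codeStacks_update (S : ∀ k, List (Γ k)) (k : K) (x : List (Γ k)) :
    codeStacks ι (Function.update S k x) =
      Function.update (codeStacks ι S) (ι k) (x.map Encodable.encode) := by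
  funext i
  obtain ⟨j, rfl⟩ := ι.surjective i
  rw [codeStacks_apply]
  by_cases hj : j = k
  · subst hj; simp
  · rw [Function.update_of_ne hj, Function.update_of_ne (by simpa using hj), codeStacks_apply]

variable [Primcodable Λ] [Primcodable σ] [Finite σ] [∀ k, Finite (Γ k)]

/-- The functions on internal states inside a statement are arbitrary, so the state `v` is kept as a
parameter. Where a popped or peeked symbol changes the state, the finitely many resulting functions
are glued by `Primrec₂.of_finite_left`. -/
theorem exists_primrec_stepAux (q : Stmt Γ Λ σ) (v : σ) :
    ∃ F : (Fin n → List ℕ) → Option Λ × σ × (Fin n → List ℕ), Primrec F ∧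
      ∀ S, F (codeStacks ι S) = codeCfg ι (stepAux q v S) := by
  induction q generalizing v with
  | push k f q ih =>
    obtain ⟨F, hF, hFS⟩ := ih v
    refine ⟨fun S => F (Function.update S (ι k) (Encodable.encode (f v) :: S (ι k))),
      hF.comp (Primrec.fin_update _ (Primrec.list_cons.comp (Primrec.const _)
        (Primrec.fin_app.comp Primrec.id (Primrec.const (ι k))))), fun S => ?_⟩
    rw [stepAux, ← hFS, codeStacks_update, List.map_cons, ← codeStacks_apply ι]
  | peek k f q ih =>
    choose F hF hFS using ih
    refine ⟨fun S => F (f v ((S (ι k)).head?.bind fun x => Encodable.decode x)) S,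
      (Primrec₂.of_finite_left hF).comp
        ((Primrec.dom_finite (f v)).comp (primrec_decodeHead ι k)) Primrec.id, fun S => ?_⟩
    rw [stepAux, ← hFS, ← decodeHead_codeStacks ι S k]
  | pop k f q ih =>
    choose F hF hFS using ih
    refine ⟨fun S => F (f v ((S (ι k)).head?.bind fun x => Encodable.decode x))
        (Function.update S (ι k) (S (ι k)).tail),
      (Primrec₂.of_finite_left hF).comp
        ((Primrec.dom_finite (f v)).comp (primrec_decodeHead ι k))
        (Primrec.fin_update _ (Primrec.list_tail.comp
          (Primrec.fin_app.comp Primrec.id (Primrec.const (ι k))))), fun S => ?_⟩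
    rw [stepAux, ← hFS, ← decodeHead_codeStacks ι S k, codeStacks_update, List.map_tail,
      ← codeStacks_apply ι]
  | load f q ih =>
    obtain ⟨F, hF, hFS⟩ := ih (f v)
    exact ⟨F, hF, fun S => by rw [stepAux, hFS]⟩
  | branch f q₁ q₂ ih₁ ih₂ =>
    obtain ⟨F₁, hF₁, hFS₁⟩ := ih₁ v
    obtain ⟨F₂, hF₂, hFS₂⟩ := ih₂ v
    rcases hb : f v
    · exact ⟨F₂, hF₂, fun S => by rw [stepAux, hFS₂, hb]; rfl⟩
    · exact ⟨F₁, hF₁, fun S => by rw [stepAux, hFS₁, hb]; rfl⟩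
  | goto f =>
    exact ⟨fun S => (some (f v), v, S), Primrec.pair (Primrec.const _)
      (Primrec.pair (Primrec.const _) Primrec.id), fun S => rfl⟩
  | halt =>
    exact ⟨fun S => (none, v, S), Primrec.pair (Primrec.const _)
      (Primrec.pair (Primrec.const _) Primrec.id), fun S => rfl⟩

theorem exists_primrec_next [Finite Λ] (M : Λ → Stmt Γ Λ σ) :
    ∃ F : Option Λ × σ × (Fin n → List ℕ) → Option Λ × σ × (Fin n → List ℕ), Primrec F ∧
      ∀ c, F (codeCfg ι c) = codeCfg ι (next M c) := by
  have h : ∀ p : Option Λ × σ,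
      ∃ F : (Fin n → List ℕ) → Option Λ × σ × (Fin n → List ℕ), Primrec F ∧
        ∀ S, F (codeStacks ι S) = codeCfg ι (next M ⟨p.1, p.2, S⟩) := by
    rintro ⟨_ | q, v⟩
    · exact ⟨fun S => (none, v, S), Primrec.pair (Primrec.const _)
        (Primrec.pair (Primrec.const _) Primrec.id), fun S => rfl⟩
    · exact exists_primrec_stepAux ι (M q) v
  choose F hF hFS using h
  exact ⟨fun c => F (c.1, c.2.1) c.2.2,
    (Primrec₂.of_finite_left hF).comp
      (Primrec.pair Primrec.fst (Primrec.fst.comp Primrec.snd)) (Primrec.snd.comp Primrec.snd),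
    fun c => hFS (c.l, c.var) c.stk⟩

end Primrec

end Turing.TM2

/-- A finite type is primitive recursively codable. -/
noncomputable abbrev Primcodable.ofFinite (α : Type*) [Finite α] : Primcodable α :=
  Primcodable.ofEquiv _ (Finite.equivFin α)

open Turing in
/-- Polynomial time computable learning functions are primitive recursive. -/
theorem PolyTimeComputable.primrec {l : LearningFunction} (hl : PolyTimeComputable l) :
    Primrec l := by
  obtain ⟨⟨⟨tm, inA, outA⟩, time, hout⟩, hfin⟩ := hl
  dsimp only at inA outA hout hfin
  obtain ⟨n, ⟨ι⟩⟩ := @Finite.exists_equiv_fin tm.K (@Finite.of_fintype _ tm.kFin)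
  have : Finite tm.Λ := @Finite.of_fintype _ tm.ΛFin
  have : Finite tm.σ := @Finite.of_fintype _ tm.σFin
  let : ∀ k, Primcodable (tm.Γ k) := fun k => Primcodable.ofFinite _
  let : Primcodable tm.Λ := Primcodable.ofFinite _
  let : Primcodable tm.σ := Primcodable.ofFinite _
  obtain ⟨F, hF, hFS⟩ := TM2.exists_primrec_next ι tm.m
  have hiter : ∀ (t : ℕ) c, F^[t] (TM2.codeCfg ι c) = TM2.codeCfg ι ((TM2.next tm.m)^[t] c) := by
    intro t
    induction t with
    | zero => exact fun c => rfl
    | succ t ih =>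
      intro c
      rw [Function.iterate_succ_apply, hFS, ih, Function.iterate_succ_apply]
  have hinit : ∀ w : List Bool, TM2.codeStacks ι (initList tm (w.map inA.invFun)).stk =
      Function.update (fun _ => []) (ι tm.k₀) (w.map fun b => Encodable.encode (inA.symm b)) := by
    intro w
    funext i
    obtain ⟨k, rfl⟩ := ι.surjective i
    rw [TM2.codeStacks_apply]
    by_cases hk : k = tm.k₀
    · subst hk
      simp [initList, Function.comp_def]
    · rw [Function.update_of_ne (by simpa using hk)]
      simp [initList, hk]
  have hrun : ∀ w : List Bool,
      (F^[time.eval w.length] (some tm.main, tm.initialState,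
        Function.update (fun _ => []) (ι tm.k₀)
          (w.map fun b => Encodable.encode (inA.symm b)))).2.2 (ι tm.k₁)
        = [Encodable.encode (outA.symm (l w))] := by
    intro w
    obtain ⟨⟨t, ht⟩, htle⟩ := hout w
    have h1 : (TM2.next tm.m)^[t] (initList tm (w.map inA.invFun)) =
        haltList tm ([l w].map outA.invFun) := TM2.iterate_next_of_bind_step ht
    have h2 : (TM2.next tm.m)^[time.eval w.length] (initList tm (w.map inA.invFun)) =
        haltList tm ([l w].map outA.invFun) :=
      TM2.iterate_next_of_le h1 rfl htle
    have h3 := hiter (time.eval w.length) (initList tm (w.map inA.invFun))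
    rw [h2] at h3
    have h4 : TM2.codeCfg ι (initList tm (w.map inA.invFun)) = (some tm.main, tm.initialState,
        Function.update (fun _ => []) (ι tm.k₀)
          (w.map fun b => Encodable.encode (inA.symm b))) := by
      rw [← hinit]
      rfl
    rw [← h4, h3]
    change TM2.codeStacks ι _ (ι tm.k₁) = _
    rw [TM2.codeStacks_apply]
    simp [haltList]
  have hmap : Primrec fun w : List Bool => w.map fun b => Encodable.encode (inA.symm b) :=
    Primrec.list_map Primrec.id
      ((Primrec.dom_bool fun b => Encodable.encode (inA.symm b)).comp Primrec.snd)
  have hstk : Primrec fun w : List Bool => (Function.update (fun _ => []) (ι tm.k₀)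
      (w.map fun b => Encodable.encode (inA.symm b)) : Fin n → List ℕ) := by
    refine Primrec.fin_curry.2 ?_
    refine (Primrec.ite (c := fun p : List Bool × Fin n => p.2 = ι tm.k₀)
      (Primrec.eq.comp Primrec.snd (Primrec.const _)) (hmap.comp Primrec.fst)
      (Primrec.const [])).of_eq fun p => ?_
    simp [Function.update_apply]
  have hfull : Primrec fun w : List Bool =>
      (F^[time.eval w.length] (some tm.main, tm.initialState,
        Function.update (fun _ => []) (ι tm.k₀)
          (w.map fun b => Encodable.encode (inA.symm b)))).2.2 (ι tm.k₁) :=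
    Primrec.fin_app.comp (Primrec.snd.comp (Primrec.snd.comp (Primrec.nat_iterate
      ((Polynomial.primrec_eval_nat time).comp Primrec.list_length)
      (Primrec.pair (Primrec.const _) (Primrec.pair (Primrec.const _) hstk))
      (hF.comp Primrec.snd)))) (Primrec.const _)
  have hdec : Primrec fun w : List Bool =>
      decide (((F^[time.eval w.length] (some tm.main, tm.initialState,
        Function.update (fun _ => []) (ι tm.k₀)
          (w.map fun b => Encodable.encode (inA.symm b)))).2.2 (ι tm.k₁)) =
        [Encodable.encode (outA.symm true)]) :=
    Primrec.eq.decide.comp hfull (Primrec.const _)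
  refine hdec.of_eq fun w => ?_
  rw [hrun]
  cases l w <;> simp

/-! ### Prefixes and cylinders. -/

namespace Cantor

@[simp]
theorem length_take (Z : Cantor) (n : ℕ) : (Z.take n).length = n := by
  simp [Cantor.take]

theorem take_take (Z : Cantor) {m n : ℕ} (h : m ≤ n) : (Z.take n).take m = Z.take m := by
  rw [Cantor.take, ← List.map_take, List.take_range, min_eq_left h, Cantor.take]

theorem take_succ (Z : Cantor) (n : ℕ) : Z.take (n + 1) = Z.take n ++ [Z n] := by
  simp [Cantor.take, List.range_succ]

theorem take_isPrefix (Z : Cantor) {m n : ℕ} (h : m ≤ n) : Z.take m <+: Z.take n := by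
  rw [← Z.take_take h]
  exact List.take_prefix _ _

theorem mem_cylinderAt_take (Z : Cantor) (n : ℕ) : Z ∈ cylinderAt (Z.take n) := by
  simp [cylinderAt]

theorem mem_cylinderAt_of_isPrefix {Z : Cantor} {w : List Bool} {n : ℕ} (h : w <+: Z.take n) :
    Z ∈ cylinderAt w := by
  have hle : w.length ≤ n := by simpa using h.length_le
  rw [cylinderAt, Set.mem_ofPred_eq, ← Z.take_take hle]
  exact (List.prefix_iff_eq_take.1 h).symm

theorem isPrefix_take_of_mem_cylinderAt {Z : Cantor} {w : List Bool} (h : Z ∈ cylinderAt w)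
    {n : ℕ} (hn : w.length ≤ n) : w <+: Z.take n := by
  have h' : Z.take w.length = w := h
  have := Z.take_isPrefix hn
  rwa [h'] at this

end Cantor

theorem measurableSet_cylinderAt (w : List Bool) : MeasurableSet (cylinderAt w) := by
  have h : cylinderAt w = ⋂ i : Fin w.length, (fun Z : Cantor => Z i) ⁻¹' {w[i]} := by
    ext Z
    simp only [cylinderAt, Cantor.take, Set.mem_ofPred_eq, Set.mem_iInter, Set.mem_preimage,
      Set.mem_singleton_iff]
    constructor
    · intro hZ i
      have := List.getElem_of_eq hZ (i := i) (by simp)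
      simpa using this
    · intro hZ
      exact List.ext_getElem (by simp) fun i h1 h2 => by simpa using hZ ⟨i, h2⟩
  rw [h]
  exact MeasurableSet.iInter fun i => measurable_pi_apply _ (measurableSet_singleton _)

/-! ### From a detecting learner to a Martin-Löf test. -/

/-- The number of prefixes of `w`, itself included, which `l` accepts. -/
def yesCount (l : LearningFunction) (w : List Bool) : ℕ :=
  Nat.count (fun i => l (w.take i) = true) (w.length + 1)

theorem yesCount_take (l : LearningFunction) (Z : Cantor) (n : ℕ) :
    yesCount l (Z.take n) = Nat.count (fun i => l (Z.take i) = true) (n + 1) := by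
  rw [yesCount, Cantor.length_take, Nat.count_eq_card_filter_range, Nat.count_eq_card_filter_range]
  congr 1
  refine Finset.filter_congr fun i hi => ?_
  rw [Z.take_take (by simpa [Nat.lt_succ_iff] using hi)]

theorem primrec_yesCount {l : LearningFunction} (hl : Primrec l) : Primrec (yesCount l) := by
  have h : Primrec₂ fun (w : List Bool) (n : ℕ) => Nat.count (fun i => l (w.take i) = true) n := by
    refine (Primrec.nat_rec (f := fun _ : List Bool => 0)
      (g := fun w p => p.2 + bif l (w.take p.1) then 1 else 0) (Primrec.const 0)
      (Primrec.nat_add.comp (Primrec.snd.comp Primrec.snd)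
        (Primrec.cond (hl.comp (Primrec.list_take.comp (Primrec.fst.comp Primrec.snd) Primrec.fst))
          (Primrec.const 1) (Primrec.const 0)))).of_eq fun w n => ?_
    induction n with
    | zero => simp
    | succ n ih =>
      rw [Nat.count_succ, ← ih]
      change _ + (bif l (w.take n) then 1 else 0) = _
      cases l (w.take n) <;> simp
  exact h.comp Primrec.id (Primrec.succ.comp Primrec.list_length)

/-- The strings at which `l` says yes for the `n`-th time. -/
def nthYesStrings (l : LearningFunction) (n : ℕ) : Set (List Bool) :=
  {w | l w = true ∧ yesCount l w = n}

/-- The count goes up at each yes, so along one sequence the `n`-th yes occurs only once. This makes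
the cylinders disjoint. -/
theorem nthYesStrings_eq_of_take {l : LearningFunction} {n : ℕ} {Z : Cantor} {i j : ℕ}
    (hi : Z.take i ∈ nthYesStrings l n) (hj : Z.take j ∈ nthYesStrings l n) : i = j := by
  wlog hij : i < j generalizing i j
  · rcases (not_lt.1 hij).eq_or_lt with h | h
    · exact h.symm
    · exact (this hj hi h).symm
  obtain ⟨-, hi⟩ := hi
  obtain ⟨hj, hj'⟩ := hj
  rw [yesCount_take] at hi hj'
  rw [Nat.count_succ, if_pos hj] at hj'
  have := Nat.count_monotone (fun i => l (Z.take i) = true) (Nat.succ_le_of_lt hij)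
  simp only [Nat.succ_eq_add_one] at this
  omega

theorem tsum_nthYesStrings_le {l : LearningFunction} {X : Cantor} (h : UniformlyWeaklyDetects l X)
    (n : ℕ) [DecidablePred (· ∈ nthYesStrings l n)] :
    ∑' w, cantorLebesgue (if w ∈ nthYesStrings l n then cylinderAt w else ∅) ≤
      (2 : ENNReal)⁻¹ ^ n := by
  rw [← measure_iUnion]
  · refine (measure_mono ?_).trans (h.2 n)
    intro Z hZ
    obtain ⟨w, hw⟩ := Set.mem_iUnion.1 hZ
    split_ifs at hw with hmem
    · obtain ⟨hl, hc⟩ := hmem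
      have hZw : Z.take w.length = w := hw
      rw [← hZw, yesCount_take, Nat.count_eq_card_filter_range] at hc
      have hsub : (((Finset.range (w.length + 1)).filter fun i => l (Z.take i) = true : Finset ℕ) :
          Set ℕ) ⊆ {m | l (Z.take m) = true} := fun i hi => by
        simpa using (Finset.mem_filter.1 (Finset.mem_coe.1 hi)).2
      have := Set.encard_le_encard hsub
      rwa [Set.encard_coe_eq_coe_finsetCard, hc] at this
    · exact hw.elim
  · intro u v huv
    refine Set.disjoint_left.2 fun Z hu hv => huv ?_
    dsimp only at hu hv
    split_ifs at hu hv with h1 h2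
    · have hu' : Z.take u.length = u := hu
      have hv' : Z.take v.length = v := hv
      rw [← hu'] at h1
      rw [← hv'] at h2
      rw [← hu', ← hv', nthYesStrings_eq_of_take h1 h2]
    all_goals simp_all
  · intro w
    split_ifs
    exacts [measurableSet_cylinderAt w, MeasurableSet.empty]

theorem tsum_two_inv_pow_add_succ (k : ℕ) :
    ∑' i : ℕ, (2 : ENNReal)⁻¹ ^ (i + k + 1) = (2 : ENNReal)⁻¹ ^ k := by
  have : ∀ i : ℕ, (2 : ENNReal)⁻¹ ^ (i + k + 1) = (2 : ENNReal)⁻¹ ^ k * 2⁻¹ ^ (i + 1) := fun i => by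
    rw [← pow_add]; congr 1; omega
  simp_rw [this]
  rw [ENNReal.tsum_mul_left, ENNReal.tsum_geometric_add_one, ENNReal.one_sub_inv_two, inv_inv,
    ENNReal.inv_mul_cancel two_ne_zero ENNReal.ofNat_ne_top, mul_one]

/-- A sequence detected by a primitive recursive learning function has algorithmic measure
zero. -/
theorem UniformlyWeaklyDetects.algorithmicMeasureZero {l : LearningFunction} {X : Cantor}
    (hl : Primrec l) (h : UniformlyWeaklyDetects l X) :
    AlgorithmicMeasureZero cantorLebesgue {X} := by
  classical
  -- A test must list a string at every index. Useless indices get a string of length `i + k + 2`;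
  -- these fillers have total mass at most `2^(-(k+1))`. Row `k` uses the `(k+1)`-th yes, whose mass
  -- is at most the other half of `2^(-k)`.
  let pad : ℕ → ℕ → List Bool := fun k i => (List.range (i + (k + 1) + 1)).map fun _ => false
  let g : ℕ → ℕ → List Bool := fun k i => Option.casesOn (Encodable.decode₂ (List Bool) i)
    (pad k i) fun w => if l w = true ∧ yesCount l w = k + 1 then w else pad k i
  have hpad : Primrec₂ pad := Primrec.list_map (Primrec.list_range.comp
    (Primrec.succ.comp (Primrec.nat_add.comp Primrec.snd (Primrec.succ.comp Primrec.fst))))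
    (Primrec.const false).to₂
  have hg : Primrec₂ g := by
    refine Primrec.option_casesOn (Primrec.decode₂.comp Primrec.snd) hpad
      (Primrec.ite (PrimrecPred.and ?_ ?_) Primrec.snd (hpad.comp
        (Primrec.fst.comp Primrec.fst) (Primrec.snd.comp Primrec.fst)))
    · exact Primrec.eq.comp (hl.comp Primrec.snd) (Primrec.const true)
    · exact Primrec.eq.comp ((primrec_yesCount hl).comp Primrec.snd)
        (Primrec.succ.comp (Primrec.fst.comp Primrec.fst))
  refine ⟨g, hg.to_comp, fun k => ⟨?_, ?_⟩⟩
  · rw [Set.singleton_subset_iff]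
    let p : ℕ → Prop := fun i => l (X.take i) = true
    have hinf : {i | p i}.Infinite := h.1
    -- `Nat.nth` counts from zero, so this is the `(k+1)`-th yes.
    let m := Nat.nth p k
    have hm : p m := Nat.nth_mem_of_infinite hinf k
    have hcount : yesCount l (X.take m) = k + 1 := by
      rw [yesCount_take, Nat.count_succ, if_pos hm]
      exact congrArg (· + 1) (Nat.count_nth_of_infinite hinf k)
    refine Set.mem_iUnion.2 ⟨Encodable.encode (X.take m), ?_⟩
    have : g k (Encodable.encode (X.take m)) = X.take m := by
      simp only [g, Encodable.encodek₂]
      exact if_pos ⟨hm, hcount⟩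
    rw [this]
    exact X.mem_cylinderAt_take m
  · calc ∑' i, cantorLebesgue (cylinderAt (g k i))
        ≤ ∑' i, (cantorLebesgue (⋃ w ∈ Encodable.decode₂ (List Bool) i,
            if w ∈ nthYesStrings l (k + 1) then cylinderAt w else ∅) +
            (2 : ENNReal)⁻¹ ^ (i + (k + 1) + 1)) := by
          refine ENNReal.tsum_le_tsum fun i => ?_
          have hpadμ : cantorLebesgue (cylinderAt (pad k i)) =
              (2 : ENNReal)⁻¹ ^ (i + (k + 1) + 1) := by
            rw [cantorLebesgue_cylinderAt]
            simp [pad]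
          rcases hd : Encodable.decode₂ (List Bool) i with _ | w
          · simp only [g, hd, hpadμ]
            exact le_add_self
          · by_cases hw : l w = true ∧ yesCount l w = k + 1
            · have hw' : w ∈ nthYesStrings l (k + 1) := hw
              simp [g, hd, hw, hw']
            · simp only [g, hd, if_neg hw, hpadμ]
              exact le_add_self
      _ = ∑' w, cantorLebesgue (if w ∈ nthYesStrings l (k + 1) then cylinderAt w else ∅) +
            (2 : ENNReal)⁻¹ ^ (k + 1) := by
          rw [ENNReal.tsum_add, tsum_two_inv_pow_add_succ,
            tsum_iUnion_decode₂ (fun s => cantorLebesgue s) (by simp)]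
      _ ≤ (2 : ENNReal)⁻¹ ^ (k + 1) + (2 : ENNReal)⁻¹ ^ (k + 1) := by
          gcongr
          exact tsum_nthYesStrings_le h (k + 1)
      _ = (2 : ENNReal)⁻¹ ^ k := by
          rw [pow_succ, ← mul_add, ENNReal.inv_two_add_inv_two, mul_one]

/-! ### From a Martin-Löf test to a computable learner. -/

/-- Whether one of `u 0, …, u (n - 1)` is a prefix of `w`. -/
def hits (u : ℕ → List Bool) (w : List Bool) : ℕ → Bool
  | 0 => false
  | n + 1 => hits u w n || decide (w.take (u n).length = u n)

theorem hits_eq_true_iff {u : ℕ → List Bool} {w : List Bool} {n : ℕ} :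
    hits u w n = true ↔ ∃ i < n, u i <+: w := by
  induction n with
  | zero => simp [hits]
  | succ n ih =>
    rw [hits, Bool.or_eq_true, ih, decide_eq_true_eq, eq_comm, ← List.prefix_iff_eq_take]
    simp only [Nat.lt_succ_iff_lt_or_eq, or_and_right, exists_or, exists_eq_left]

/-- The level reached after `m` bits of `w`: it increases whenever the part of `w` seen so far
has a prefix among the first few strings covering the next level. -/
def testLevel (g : ℕ → ℕ → List Bool) (w : List Bool) : ℕ → ℕ
  | 0 => 0
  | m + 1 => testLevel g w m +
      bif hits (g (testLevel g w m + 1)) (w.take (m + 1)) (m + 1) then 1 else 0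

/-- The learning function which says yes whenever the level increases. -/
def testLearner (g : ℕ → ℕ → List Bool) : LearningFunction := fun w =>
  hits (g (testLevel g w (w.length - 1) + 1)) w w.length

section Computable

variable {g : ℕ → ℕ → List Bool}

theorem computable_hits (hg : Computable₂ g) {α : Type*} [Primcodable α] {j n : α → ℕ}
    {w : α → List Bool} (hj : Computable j) (hw : Computable w) (hn : Computable n) :
    Computable fun a => hits (g (j a)) (w a) (n a) := by
  have hgi : Computable fun p : α × ℕ × Bool => g (j p.1) p.2.1 :=
    hg.comp (hj.comp Computable.fst) (Computable.fst.comp Computable.snd)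
  have htake : Computable fun p : α × ℕ × Bool => (w p.1).take (g (j p.1) p.2.1).length :=
    Primrec.list_take.to_comp.comp (Computable.list_length.comp hgi) (hw.comp Computable.fst)
  refine (Computable.nat_rec (g := fun _ : α => false) (h := fun a p =>
    p.2 || decide ((w a).take (g (j a) p.1).length = g (j a) p.1)) hn (Computable.const false)
    (Primrec.or.to_comp.comp (Computable.snd.comp Computable.snd)
      (Primrec.eq.decide.to_comp.comp htake hgi))).of_eq fun a => ?_
  induction n a with
  | zero => rfl
  | succ n ih => rw [hits, ← ih]

theorem computable_testLevel (hg : Computable₂ g) : Computable₂ (testLevel g) := by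
  refine (Computable.nat_rec (f := fun p : List Bool × ℕ => p.2) (g := fun _ => 0)
    (h := fun p q => q.2 + bif hits (g (q.2 + 1)) (p.1.take (q.1 + 1)) (q.1 + 1) then 1 else 0)
    Computable.snd (Computable.const 0) ?_).of_eq fun p => ?_
  · have hlev : Computable fun x : (List Bool × ℕ) × ℕ × ℕ => x.2.2 :=
      Computable.snd.comp Computable.snd
    have hm : Computable fun x : (List Bool × ℕ) × ℕ × ℕ => x.2.1 + 1 :=
      Computable.succ.comp (Computable.fst.comp Computable.snd)
    exact Primrec.nat_add.to_comp.comp hlev (Computable.cond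
      (computable_hits hg (Computable.succ.comp hlev)
        (Primrec.list_take.to_comp.comp hm (Computable.fst.comp Computable.fst)) hm)
      (Computable.const 1) (Computable.const 0))
  · obtain ⟨w, m⟩ := p
    dsimp only
    induction m with
    | zero => rfl
    | succ m ih => rw [testLevel, ← ih]

theorem computable_testLearner (hg : Computable₂ g) : Computable (testLearner g) :=
  computable_hits hg (Computable.succ.comp ((computable_testLevel hg).comp Computable.id
    (Computable.pred.comp Computable.list_length))) Computable.id Computable.list_length

end Computable

section Detection

variable (g : ℕ → ℕ → List Bool) (Y : Cantor)

/-- The level rises exactly at the yes answers, and it depends only on the bits read so far. The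
empty prefix contributes nothing, as no strings have been inspected yet. -/
theorem testLevel_take {m n : ℕ} (h : m ≤ n) :
    testLevel g (Y.take n) m = Nat.count (fun i => testLearner g (Y.take i) = true) (m + 1) := by
  induction m generalizing n with
  | zero => simp [testLevel, testLearner, Nat.count_succ, hits]
  | succ m ih =>
    have hlearn : testLearner g (Y.take (m + 1)) = hits (g (testLevel g (Y.take n) m + 1))
        ((Y.take n).take (m + 1)) (m + 1) := by
      rw [testLearner, Y.take_take h, Cantor.length_take, Nat.add_sub_cancel,
        ih (Nat.le_succ m), ih (Nat.le_of_succ_le h)]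
    rw [testLevel, Nat.count_succ, ← ih (Nat.le_of_succ_le h), ← hlearn]
    cases testLearner g (Y.take (m + 1)) <;> simp

theorem testLearner_take_succ (m : ℕ) :
    testLearner g (Y.take (m + 1)) = true ↔ ∃ i < m + 1,
      g (Nat.count (fun i => testLearner g (Y.take i) = true) (m + 1) + 1) i <+:
        Y.take (m + 1) := by
  rw [testLearner, Cantor.length_take, Nat.add_sub_cancel, testLevel_take g Y (Nat.le_succ m),
    hits_eq_true_iff]

variable {g Y}

/-- The `(n+1)`-th yes is given at level `n`, hence because of a string in row `n + 1`. -/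
theorem mem_cover_of_encard_testLearner {n : ℕ}
    (h : ((n + 1 : ℕ) : ℕ∞) ≤ {m : ℕ | testLearner g (Y.take m) = true}.encard) :
    Y ∈ ⋃ i, cylinderAt (g (n + 1) i) := by
  let p : ℕ → Prop := fun m => testLearner g (Y.take m) = true
  have hcard : ∀ hf : {m | p m}.Finite, n < hf.toFinset.card := by
    intro hf
    change ((n + 1 : ℕ) : ℕ∞) ≤ {m | p m}.encard at h
    rw [hf.encard_eq_coe_toFinset_card] at h
    exact_mod_cast h
  have hp : p (Nat.nth p n) := Nat.nth_mem n hcard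
  have hc : Nat.count p (Nat.nth p n) = n := Nat.count_nth hcard
  rcases hm : Nat.nth p n with _ | m
  · rw [hm] at hp
    cases hp
  · rw [hm] at hp hc
    obtain ⟨i, -, hi⟩ := (testLearner_take_succ g Y m).1 hp
    rw [hc] at hi
    exact Set.mem_iUnion.2 ⟨i, Cantor.mem_cylinderAt_of_isPrefix hi⟩

/-- After a last yes the level would be constant, yet the next row contains a prefix of `Y`, which
is eventually found. -/
theorem infinite_testLearner (h : ∀ k, Y ∈ ⋃ i, cylinderAt (g k i)) :
    {m : ℕ | testLearner g (Y.take m) = true}.Infinite := by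
  intro hfin
  let p : ℕ → Prop := fun m => testLearner g (Y.take m) = true
  obtain ⟨N, hN⟩ := hfin.bddAbove
  have hcount : ∀ m, Nat.count p (N + 1 + m) = Nat.count p (N + 1) := by
    intro m
    induction m with
    | zero => rfl
    | succ m ih =>
      rw [← add_assoc, Nat.count_succ, ih, if_neg, add_zero]
      exact fun hp => absurd (hN hp) (by omega)
  obtain ⟨i, hi⟩ := Set.mem_iUnion.1 (h (Nat.count p (N + 1) + 1))
  -- Large enough that index `i` is among those inspected and that the string fits into the data
  -- read.
  let d := i + (g (Nat.count p (N + 1) + 1) i).length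
  have hyes : testLearner g (Y.take (N + d + 1)) = true := by
    refine (testLearner_take_succ g Y (N + d)).2 ⟨i, by omega, ?_⟩
    have : Nat.count (fun i => testLearner g (Y.take i) = true) (N + d + 1) =
        Nat.count p (N + 1) := by
      rw [show N + d + 1 = N + 1 + d by omega]
      exact hcount d
    rw [this]
    exact Cantor.isPrefix_take_of_mem_cylinderAt hi (by omega)
  exact absurd (hN hyes) (by omega)

end Detection

/-- A sequence covered by a test is detected by the learning function of the test. -/
theorem uniformlyWeaklyDetects_testLearner {g : ℕ → ℕ → List Bool} {X : Cantor}
    (hX : ∀ k, X ∈ ⋃ i, cylinderAt (g k i))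
    (hg : ∀ k, ∑' i, cantorLebesgue (cylinderAt (g k i)) ≤ (2 : ENNReal)⁻¹ ^ k) :
    UniformlyWeaklyDetects (testLearner g) X := by
  refine ⟨infinite_testLearner hX, fun n => ?_⟩
  rcases n with _ | n
  · rw [← List.length_nil (α := Bool), ← cantorLebesgue_cylinderAt]
    exact measure_mono fun Y _ => rfl
  · exact (measure_mono fun Y hY => mem_cover_of_encard_testLearner hY).trans
      ((measure_iUnion_le _).trans (hg (n + 1)))

/-! ### Step counts, reachable labels and stack growth. -/

namespace Turing.TM2

variable {K : Type} [DecidableEq K] {Γ : K → Type} {Λ σ : Type}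

/-- `M` gets from `a` to `b` in exactly `n` steps. -/
def ReachesIn (M : Λ → Stmt Γ Λ σ) (n : ℕ) (a b : Cfg Γ Λ σ) : Prop :=
  (flip bind (step M))^[n] (some a) = some b

theorem ReachesIn.trans {M : Λ → Stmt Γ Λ σ} {m n : ℕ} {a b c : Cfg Γ Λ σ}
    (hab : ReachesIn M m a b) (hbc : ReachesIn M n b c) : ReachesIn M (m + n) a c := by
  rw [ReachesIn, add_comm, Function.iterate_add_apply, hab]
  exact hbc

theorem ReachesIn.head {M : Λ → Stmt Γ Λ σ} {n : ℕ} {q : Λ} {v : σ} {S : ∀ k, List (Γ k)}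
    {c : Cfg Γ Λ σ} (h : ReachesIn M n (stepAux (M q) v S) c) :
    ReachesIn M (n + 1) ⟨some q, v, S⟩ c := h

/-- A bound for the number of symbols a statement pushes on a stack. -/
def Stmt.pushes : Stmt Γ Λ σ → ℕ
  | .push _ _ q => q.pushes + 1
  | .peek _ _ q => q.pushes
  | .pop _ _ q => q.pushes
  | .load _ q => q.pushes
  | .branch _ q₁ q₂ => max q₁.pushes q₂.pushes
  | .goto _ => 0
  | .halt => 0

theorem length_stk_stepAux_le (q : Stmt Γ Λ σ) (v : σ) (S : ∀ k, List (Γ k)) (k : K) :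
    ((stepAux q v S).stk k).length ≤ (S k).length + q.pushes := by
  induction q generalizing v S with
  | push j f q ih =>
    refine (ih _ _).trans ?_
    rcases eq_or_ne k j with rfl | h
    · simp only [Stmt.pushes, Function.update_self, List.length_cons]; omega
    · simp only [Stmt.pushes, Function.update_of_ne h]; omega
  | peek j f q ih => exact ih _ _
  | pop j f q ih =>
    refine (ih _ _).trans ?_
    rcases eq_or_ne k j with rfl | h
    · simp [Stmt.pushes]
    · simp [Stmt.pushes, h]
  | load f q ih => exact ih _ _
  | branch f q₁ q₂ ih₁ ih₂ =>
    rw [stepAux, Stmt.pushes]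
    cases f v
    · exact (ih₂ _ _).trans (by omega)
    · exact (ih₁ _ _).trans (by omega)
  | goto f => simp [Stmt.pushes]
  | halt => simp [Stmt.pushes]

theorem next_l_mem_insertNone {M : Λ → Stmt Γ Λ σ} {s : Finset Λ}
    (hs : ∀ q ∈ s, SupportsStmt s (M q)) {c : Cfg Γ Λ σ} (hc : c.l ∈ Finset.insertNone s) :
    (next M c).l ∈ Finset.insertNone s := by
  rcases c with ⟨_ | q, v, S⟩
  · exact hc
  · have hq : q ∈ s := Finset.some_mem_insertNone.1 hc
    -- Mathlib's `Supports` asks for the default label to lie in `s`; the current label serves.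
    let : Inhabited Λ := ⟨q⟩
    exact step_supports M ⟨hq, hs⟩ (c := ⟨some q, v, S⟩) rfl hc

theorem length_stk_next_le (M : Λ → Stmt Γ Λ σ) {s : Finset Λ} {c : Cfg Γ Λ σ}
    (hc : c.l ∈ Finset.insertNone s) (k : K) :
    ((next M c).stk k).length ≤ (c.stk k).length + s.sup fun q => (M q).pushes := by
  rcases c with ⟨_ | q, v, S⟩
  · exact Nat.le_add_right _ _
  · refine (length_stk_stepAux_le (M q) v S k).trans (Nat.add_le_add_left ?_ _)
    exact Finset.le_sup (f := fun q => (M q).pushes) (Finset.some_mem_insertNone.1 hc)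

end Turing.TM2

/-! ### Running a machine for as many steps as the input is long. -/

namespace Turing.Clocked

open TM2 TM2.Stmt

/-- The additional stacks of a clocked machine: one for input and output, one for reversing the
input, and the clock. -/
inductive Aux
  | port
  | tmp
  | clk
  deriving DecidableEq

instance : Fintype Aux :=
  ⟨{.port, .tmp, .clk}, fun a => by cases a <;> simp⟩

/-- The labels of a clocked machine. -/
inductive Lbl (Λ : Type)
  | rev
  | load
  | run (q : Option Λ)
  | clean (b : Bool)
  deriving Fintype

section Machine

variable {K : Type} {Γ : K → Type} {Λ Λ₀ σ : Type}

/-- The stack alphabets of a clocked machine. -/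
abbrev Alphabet (Γ : K → Type) : K ⊕ Aux → Type
  | .inl k => Γ k
  | .inr _ => Bool

/-- The stacks of a clocked machine. -/
def tape (S : ∀ k, List (Γ k)) (i t c : List Bool) : ∀ k, List (Alphabet Γ k)
  | .inl k => S k
  | .inr .port => i
  | .inr .tmp => t
  | .inr .clk => c

/-- The statements of the clocked machine which execute a statement of the given one. -/
def lift (φ : Λ → Λ₀) : Stmt Γ Λ σ → Stmt (Alphabet Γ) (Lbl Λ₀) (σ × Option Bool)
  | push k f q => push (.inl k) (fun v => f v.1) (lift φ q)
  | peek k f q => peek (.inl k) (fun v o => (f v.1 o, v.2)) (lift φ q)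
  | pop k f q => pop (.inl k) (fun v o => (f v.1 o, v.2)) (lift φ q)
  | load f q => load (fun v => (f v.1, v.2)) (lift φ q)
  | branch f q₁ q₂ => branch (fun v => f v.1) (lift φ q₁) (lift φ q₂)
  | goto f => goto fun v => .run (some (φ (f v.1)))
  | halt => goto fun _ => .run none

/-- Pop each of the stacks in a list, recording whether one of them was nonempty. -/
def drain (ks : List K) (q : Stmt (Alphabet Γ) (Lbl Λ₀) (σ × Option Bool)) :
    Stmt (Alphabet Γ) (Lbl Λ₀) (σ × Option Bool) :=
  ks.foldr (fun k q => pop (.inl k) (fun v o => (v.1, if o.isSome then some true else v.2)) q) q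

/-- Run a machine for as many steps as the input is long, then apply `yes` to the label reached. -/
def machine (N : Λ → Stmt Γ Λ σ) (φ : Λ → Λ₀) (ψ : Λ₀ → Λ) (q₀ : Λ₀) (s₀ : σ) (k₀ : K)
    (e : Bool → Γ k₀) (yes : Option Λ → Bool) (ks : List K) :
    Lbl Λ₀ → Stmt (Alphabet Γ) (Lbl Λ₀) (σ × Option Bool)
  | .rev => pop (.inr .port) (fun v o => (v.1, o)) <| branch (fun v => v.2.isSome)
      (push (.inr .tmp) (fun v => v.2.getD false) <| goto fun _ => .rev) (goto fun _ => .load)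
  | .load => pop (.inr .tmp) (fun v o => (v.1, o)) <| branch (fun v => v.2.isSome)
      (push (.inl k₀) (fun v => e (v.2.getD false)) <|
        push (.inr .clk) (fun v => v.2.getD false) <| goto fun _ => .load)
      (goto fun _ => .run (some q₀))
  | .run o => pop (.inr .clk) (fun v o => (v.1, o)) <| branch (fun v => v.2.isSome)
      (o.elim (goto fun _ => .run none) fun q => lift φ (N (ψ q)))
      (goto fun _ => .clean (yes (o.map ψ)))
  | .clean b => load (fun v => (v.1, none)) <| drain ks <| branch (fun v => v.2.isSome)
      (goto fun _ => .clean b)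
      (load (fun _ => (s₀, none)) <| push (.inr .port) (fun _ => b) halt)

variable [DecidableEq K]

@[simp]
theorem update_tape_inl (S : ∀ k, List (Γ k)) (i t c : List Bool) (k : K) (x : List (Γ k)) :
    Function.update (tape S i t c) (.inl k) x = tape (Function.update S k x) i t c := by
  funext j
  rcases j with j | (_ | _ | _)
  · rcases eq_or_ne j k with rfl | h
    · simp [tape]
    · rw [Function.update_of_ne (by simpa using h)]
      simp [tape, h]
  all_goals rfl

@[simp]
theorem update_tape_port (S : ∀ k, List (Γ k)) (i t c x : List Bool) :
    Function.update (tape S i t c) (.inr .port) x = tape S x t c := by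
  funext j
  rcases j with j | (_ | _ | _) <;> rfl

@[simp]
theorem update_tape_tmp (S : ∀ k, List (Γ k)) (i t c x : List Bool) :
    Function.update (tape S i t c) (.inr .tmp) x = tape S i x c := by
  funext j
  rcases j with j | (_ | _ | _) <;> rfl

@[simp]
theorem update_tape_clk (S : ∀ k, List (Γ k)) (i t c x : List Bool) :
    Function.update (tape S i t c) (.inr .clk) x = tape S i t x := by
  funext j
  rcases j with j | (_ | _ | _) <;> rfl

/-- A whole statement is executed in one step, so the lifted statement costs a single step too.
Halting becomes a jump to `run none`, which lets the clock run out. -/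
theorem stepAux_lift (φ : Λ → Λ₀) (q : Stmt Γ Λ σ) (v : σ) (r : Option Bool)
    (S : ∀ k, List (Γ k)) (i t c : List Bool) :
    stepAux (lift φ q) (v, r) (tape S i t c) =
      ⟨some (.run ((stepAux q v S).l.map φ)), ((stepAux q v S).var, r),
        tape (stepAux q v S).stk i t c⟩ := by
  induction q generalizing v S with
  | push k f q ih => rw [lift, stepAux, update_tape_inl, ih]; rfl
  | peek k f q ih => rw [lift, stepAux, ih]; rfl
  | pop k f q ih => rw [lift, stepAux, update_tape_inl, ih]; rfl
  | load f q ih => rw [lift, stepAux, ih]; rfl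
  | branch f q₁ q₂ ih₁ ih₂ =>
    rw [lift, stepAux, ih₁, ih₂, stepAux]
    cases f v <;> rfl
  | goto f => rfl
  | halt => rfl

/-- As `ks` has no repetitions, each listed stack is popped once, and its emptiness is tested before
it changes. -/
theorem stepAux_drain (ks : List K) (hks : ks.Nodup)
    (q : Stmt (Alphabet Γ) (Lbl Λ₀) (σ × Option Bool))
    (v : σ) (r : Option Bool) (S : ∀ k, List (Γ k)) (i t c : List Bool) :
    ∃ r' : Option Bool, (r'.isSome ↔ r.isSome ∨ ∃ k ∈ ks, S k ≠ []) ∧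
      stepAux (drain ks q) (v, r) (tape S i t c) =
        stepAux q (v, r') (tape (fun k => if k ∈ ks then (S k).tail else S k) i t c) := by
  induction ks generalizing r S with
  | nil => exact ⟨r, by simp, by simp [drain]⟩
  | cons k ks ih =>
    obtain ⟨hk, hks⟩ := List.nodup_cons.1 hks
    obtain ⟨r', hr', h⟩ := ih hks (if (S k).head?.isSome then some true else r)
      (Function.update S k (S k).tail)
    refine ⟨r', ?_, ?_⟩
    · have hne : ∀ j ∈ ks, Function.update S k (S k).tail j = S j := fun j hj =>
        Function.update_of_ne (fun h : j = k => hk (h ▸ hj)) _ _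
      have : (∃ j ∈ ks, Function.update S k (S k).tail j ≠ []) ↔ ∃ j ∈ ks, S j ≠ [] :=
        exists_congr fun j => and_congr_right fun hj => by rw [hne j hj]
      rw [hr', this]
      rcases hS : S k with _ | ⟨a, x⟩ <;> simp [hS]
    · change stepAux (drain ks q) (v, if (S k).head?.isSome then some true else r)
        (Function.update (tape S i t c) (.inl k) (S k).tail) = _
      rw [update_tape_inl, h]
      congr 2
      funext j
      rcases eq_or_ne j k with rfl | hj
      · simp [hk]
      · simp [hj]

section Run

variable (N : Λ → Stmt Γ Λ σ) (φ : Λ → Λ₀) (ψ : Λ₀ → Λ) (q₀ : Λ₀) (s₀ : σ) (k₀ : K)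
    (e : Bool → Γ k₀) (yes : Option Λ → Bool) (ks : List K)

theorem reachesIn_rev (w : List Bool) (v : σ) (r : Option Bool) (S : ∀ k, List (Γ k))
    (t c : List Bool) :
    ReachesIn (machine N φ ψ q₀ s₀ k₀ e yes ks) (w.length + 1)
      ⟨some .rev, (v, r), tape S w t c⟩
      ⟨some .load, (v, none), tape S [] (w.reverse ++ t) c⟩ := by
  induction w generalizing r t with
  | nil =>
    refine ReachesIn.head ?_
    simp [machine, tape, ReachesIn]
  | cons b w ih =>
    refine ReachesIn.head ?_
    have := ih (some b) (b :: t)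
    simpa [machine, tape] using this

/-- This second reversal restores the input order on `k₀`, and leaves a copy of the input as the
clock. -/
theorem reachesIn_load (t : List Bool) (v : σ) (r : Option Bool) (S : ∀ k, List (Γ k))
    (i c : List Bool) :
    ReachesIn (machine N φ ψ q₀ s₀ k₀ e yes ks) (t.length + 1)
      ⟨some .load, (v, r), tape S i t c⟩
      ⟨some (.run (some q₀)), (v, none),
        tape (Function.update S k₀ (t.reverse.map e ++ S k₀)) i [] (t.reverse ++ c)⟩ := by
  induction t generalizing r S c with
  | nil =>
    refine ReachesIn.head ?_
    simp [machine, tape, ReachesIn]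
  | cons b t ih =>
    refine ReachesIn.head ?_
    have := ih (some b) (Function.update S k₀ (e b :: S k₀)) (b :: c)
    simpa [machine, tape] using this

/-- Each clock symbol pays for one application of `next`. Labels are recovered by `ψ` only on `s`,
so the reached label has to stay there. -/
theorem reachesIn_run {s : Finset Λ} (hs : ∀ q ∈ s, SupportsStmt s (N q))
    (hφ : ∀ q ∈ s, ψ (φ q) = q) (c : List Bool) (a : Cfg Γ Λ σ) (ha : a.l ∈ Finset.insertNone s)
    (r : Option Bool) (i t : List Bool) :
    ReachesIn (machine N φ ψ q₀ s₀ k₀ e yes ks) (c.length + 1)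
      ⟨some (.run (a.l.map φ)), (a.var, r), tape a.stk i t c⟩
      ⟨some (.clean (yes ((next N)^[c.length] a).l)), (((next N)^[c.length] a).var, none),
        tape ((next N)^[c.length] a).stk i t []⟩ := by
  induction c generalizing a r with
  | nil =>
    refine ReachesIn.head ?_
    have : (a.l.map φ).map ψ = a.l := by
      rcases hl : a.l with _ | q
      · rfl
      · rw [hl] at ha
        simp [hφ q (Finset.some_mem_insertNone.1 ha)]
    simp [machine, tape, ReachesIn, -Option.map_map, this]
  | cons b c ih =>
    refine ReachesIn.head ?_
    have h := ih (next N a) (next_l_mem_insertNone hs ha) (some b)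
    rw [← Function.iterate_succ_apply] at h
    rcases a with ⟨_ | q, v, S⟩
    · simpa [machine, tape, next] using h
    · have hq := hφ q (Finset.some_mem_insertNone.1 ha)
      simpa [machine, tape, next_some, hq, stepAux_lift] using h

/-- A halting configuration must have empty work stacks and the initial state. Each round lowers
every nonempty stack by one; the extra round finds them all empty. -/
theorem reachesIn_clean (hks : ks.Nodup) (hmem : ∀ k, k ∈ ks) (b : Bool) (n : ℕ) (v : σ)
    (r : Option Bool) (S : ∀ k, List (Γ k)) (hS : ∀ k, (S k).length ≤ n) :
    ∃ m ≤ n + 1, ReachesIn (machine N φ ψ q₀ s₀ k₀ e yes ks) m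
      ⟨some (.clean b), (v, r), tape S [] [] []⟩
      ⟨none, (s₀, none), tape (fun _ => []) [b] [] []⟩ := by
  induction n generalizing v r S with
  | zero =>
    refine ⟨1, le_rfl, ReachesIn.head ?_⟩
    obtain ⟨r', hr', h⟩ := stepAux_drain ks hks (branch (fun v => v.2.isSome)
      (goto fun _ => .clean b)
      (load (fun _ => (s₀, none)) <| push (.inr .port) (fun _ => b) halt)) v none S [] [] []
    have hnil : S = fun _ => [] := funext fun k => List.length_eq_zero_iff.1 (by simpa using hS k)
    have hr : r'.isSome = false := by
      rw [← Bool.not_eq_true, hr']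
      simp [hnil]
    rw [machine, stepAux, h]
    simp [hr, hmem, hnil, tape, ReachesIn]
  | succ n ih =>
    obtain ⟨r', hr', h⟩ := stepAux_drain ks hks (branch (fun v => v.2.isSome)
      (goto fun _ => .clean b)
      (load (fun _ => (s₀, none)) <| push (.inr .port) (fun _ => b) halt)) v none S [] [] []
    simp only [hmem, if_true] at h
    rcases hr : r'.isSome with _ | _
    · have hnil : S = fun _ => [] := by
        rw [hr] at hr'
        funext k
        by_contra hk
        simpa using hr'.2 (Or.inr ⟨k, hmem k, hk⟩)
      refine ⟨1, by omega, ReachesIn.head ?_⟩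
      rw [machine, stepAux, h]
      simp [hr, hnil, tape, ReachesIn]
    · obtain ⟨m, hm, hreach⟩ := ih v r' (fun k => (S k).tail) fun k => by
        have := hS k
        rw [List.length_tail]
        omega
      refine ⟨m + 1, by omega, ReachesIn.head ?_⟩
      rw [machine, stepAux, h]
      simpa [hr] using hreach

end Run

end Machine

end Turing.Clocked

open Turing TM2 in
/-- Running a machine for as many steps as its input is long and inspecting the label it has
reached takes polynomial time. -/
theorem polyTimeComputable_label_iterate_next {K : Type} [DecidableEq K] [Fintype K]
    {Γ : K → Type} [∀ k, Finite (Γ k)] {Λ σ : Type} [Finite σ] (N : Λ → Stmt Γ Λ σ)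
    (s : Finset Λ) (hs : ∀ q ∈ s, SupportsStmt s (N q)) (q₀ : Λ) (hq₀ : q₀ ∈ s) (s₀ : σ) (k₀ : K)
    (e : Bool → Γ k₀) (yes : Option Λ → Bool) :
    PolyTimeComputable fun w => yes ((next N)^[w.length]
      ⟨some q₀, s₀, Function.update (fun _ => []) k₀ (w.map e)⟩).l := by
  classical
  let _ : Fintype σ := Fintype.ofFinite σ
  -- The clocked machine needs a finite label type, while `Λ` may be infinite. Labels outside `s`
  -- are never reached, so their image is immaterial.
  let φ : Λ → s := fun q => if h : q ∈ s then ⟨q, h⟩ else ⟨q₀, hq₀⟩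
  have hφ : ∀ q ∈ s, (φ q : Λ) = q := fun q hq => by simp [φ, hq]
  let ks : List K := Finset.univ.toList
  let M := Clocked.machine N φ (Subtype.val : s → Λ) ⟨q₀, hq₀⟩ s₀ k₀ e yes ks
  let tm : FinTM2 :=
    { K := K ⊕ Clocked.Aux
      k₀ := .inr .port
      k₁ := .inr .port
      Γ := Clocked.Alphabet Γ
      Λ := Clocked.Lbl s
      main := .rev
      σ := σ × Option Bool
      initialState := (s₀, none)
      Γk₀Fin := inferInstanceAs (Fintype Bool)
      m := M }
  let B := s.sup fun q => (N q).pushes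
  have hrun : ∀ w : List Bool, ∃ n ≤ 4 + (4 + B) * w.length,
      ReachesIn M n ⟨some .rev, (s₀, none), Clocked.tape (fun _ => []) w [] []⟩
        ⟨none, (s₀, none), Clocked.tape (fun _ => []) [yes ((next N)^[w.length]
          ⟨some q₀, s₀, Function.update (fun _ => []) k₀ (w.map e)⟩).l] [] []⟩ := by
    intro w
    let a : Cfg Γ Λ σ := ⟨some q₀, s₀, Function.update (fun _ => []) k₀ (w.map e)⟩
    have ha : a.l ∈ Finset.insertNone s := Finset.some_mem_insertNone.2 hq₀
    have hinv : ∀ n, ((next N)^[n] a).l ∈ Finset.insertNone s ∧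
        ∀ k, (((next N)^[n] a).stk k).length ≤ w.length + n * B := by
      intro n
      induction n with
      | zero =>
        refine ⟨ha, fun k => ?_⟩
        rcases eq_or_ne k k₀ with rfl | hk
        · simp [a]
        · simp [a, hk]
      | succ n ih =>
        rw [Function.iterate_succ_apply']
        refine ⟨next_l_mem_insertNone hs ih.1, fun k => ?_⟩
        refine (length_stk_next_le N ih.1 k).trans ?_
        have := ih.2 k
        rw [Nat.succ_mul]
        change _ + B ≤ _
        omega
    have h1 := Clocked.reachesIn_rev N φ (Subtype.val : s → Λ) ⟨q₀, hq₀⟩ s₀ k₀ e yes ks w s₀ none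
      (fun _ => []) [] []
    have h2 := Clocked.reachesIn_load N φ (Subtype.val : s → Λ) ⟨q₀, hq₀⟩ s₀ k₀ e yes ks
      (w.reverse ++ []) s₀ none (fun _ => []) [] []
    simp only [List.append_nil, List.reverse_reverse, List.length_reverse] at h1 h2
    have h3 := Clocked.reachesIn_run N φ (Subtype.val : s → Λ) ⟨q₀, hq₀⟩ s₀ k₀ e yes ks hs hφ w
      a ha none [] []
    have hφ₀ : φ q₀ = ⟨q₀, hq₀⟩ := Subtype.ext (hφ q₀ hq₀)
    simp only [a, Option.map_some, hφ₀] at h3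
    obtain ⟨m, hm, h4⟩ := Clocked.reachesIn_clean N φ (Subtype.val : s → Λ) ⟨q₀, hq₀⟩ s₀ k₀ e yes ks
      (Finset.nodup_toList _) (fun k => Finset.mem_toList.2 (Finset.mem_univ k))
      (yes ((next N)^[w.length] a).l) (w.length + w.length * B) ((next N)^[w.length] a).var none
      ((next N)^[w.length] a).stk (hinv w.length).2
    -- The first three phases take `|w| + 1` steps each, the cleaning at most `|w| + |w| * B + 1`.
    refine ⟨_, ?_, ((h1.trans h2).trans h3).trans h4⟩
    nlinarith
  refine ⟨{ tm := tm, inputAlphabet := Equiv.refl Bool, outputAlphabet := Equiv.refl Bool,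
            time := Polynomial.C 4 + Polynomial.C (4 + B) * Polynomial.X, outputsFun := ?_ }, ?_⟩
  · intro w
    have hinit : ∀ w : List Bool, initList tm w =
        ⟨some .rev, (s₀, none), Clocked.tape (fun _ => []) w [] []⟩ := fun w => by
      refine congrArg (TM2.Cfg.mk _ _) (funext fun k => ?_)
      rcases k with k | (_ | _ | _) <;> rfl
    have hhalt : ∀ w : List Bool, haltList tm w =
        ⟨none, (s₀, none), Clocked.tape (fun _ => []) w [] []⟩ := fun w => by
      refine congrArg (TM2.Cfg.mk _ _) (funext fun k => ?_)
      rcases k with k | (_ | _ | _) <;> rfl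
    refine Classical.choice ?_
    obtain ⟨n, hn, hreach⟩ := hrun w
    rw [← hinit, ← hhalt] at hreach
    refine ⟨⟨⟨n, ?_⟩, ?_⟩⟩
    · have hmap : (id w).map (Equiv.refl Bool).invFun = w := List.map_id w
      rw [hmap]
      exact hreach
    · refine hn.trans (le_of_eq ?_)
      simp
  · rintro (k | k)
    · exact inferInstanceAs (Finite (Γ k))
    · exact inferInstanceAs (Finite Bool)

/-! ### Coding prefixes as numbers. -/

section PrefixNumber

/-- The number whose binary expansion is `1` followed by `v`. -/
def prefixNumber (v : List Bool) : ℕ :=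
  v.foldl (fun n b => Nat.bit b n) 1

theorem prefixNumber_concat (v : List Bool) (b : Bool) :
    prefixNumber (v ++ [b]) = Nat.bit b (prefixNumber v) := by
  simp [prefixNumber]

/-- The number itself is thus a sufficient iteration budget for `prefixOfNumber`. -/
theorem length_lt_prefixNumber (v : List Bool) : v.length < prefixNumber v := by
  induction v using List.reverseRecOn with
  | nil => simp [prefixNumber]
  | append_singleton v b ih =>
    rw [prefixNumber_concat, List.length_append, List.length_singleton, Nat.bit_val]
    omega

/-- Move the last binary digit of a number, unless it is the only one, to the front of a list. -/
def moveDigit (p : ℕ × List Bool) : ℕ × List Bool :=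
  if p.1 ≤ 1 then p else (p.1.div2, p.1.bodd :: p.2)

/-- The binary digits of a number after the leading one. -/
def prefixOfNumber (n : ℕ) : List Bool :=
  (moveDigit^[n] (n, [])).2

theorem primrec_prefixOfNumber : Primrec prefixOfNumber := by
  have h : Primrec moveDigit := Primrec.ite
    (Primrec.nat_le.comp Primrec.fst (Primrec.const 1)) Primrec.id
    (Primrec.pair (Primrec.nat_div2.comp Primrec.fst)
      (Primrec.list_cons.comp (Primrec.nat_bodd.comp Primrec.fst) Primrec.snd))
  exact Primrec.snd.comp (Primrec.nat_iterate Primrec.id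
    (Primrec.pair Primrec.id (Primrec.const [])) (h.comp Primrec.snd))

theorem iterate_moveDigit_prefixNumber (v acc : List Bool) :
    moveDigit^[v.length] (prefixNumber v, acc) = (1, v ++ acc) := by
  induction v using List.reverseRecOn generalizing acc with
  | nil => rfl
  | append_singleton v b ih =>
    have hpos : ¬ Nat.bit b (prefixNumber v) ≤ 1 := by
      have := length_lt_prefixNumber v
      rw [Nat.bit_val]
      omega
    rw [List.length_append, List.length_singleton, Function.iterate_succ_apply,
      prefixNumber_concat, moveDigit, if_neg hpos]
    simp [ih]

theorem prefixOfNumber_prefixNumber (v : List Bool) : prefixOfNumber (prefixNumber v) = v := by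
  have h : ∀ n, v.length ≤ n → moveDigit^[n] (prefixNumber v, []) = (1, v) := by
    intro n hn
    obtain ⟨d, rfl⟩ := Nat.exists_eq_add_of_le' hn
    rw [Function.iterate_add_apply, iterate_moveDigit_prefixNumber, List.append_nil]
    exact Function.iterate_fixed rfl d
  rw [prefixOfNumber, h _ (length_lt_prefixNumber v).le]

end PrefixNumber

/-! ### Evaluating a code on the successive prefixes of a stream. -/

namespace Turing

open PartrecToTM2 ToPartrec TM2 TM2.Stmt

namespace PartrecToTM2

instance : Fintype K' :=
  ⟨{.main, .rev, .aux, .stack}, fun a => by cases a <;> simp⟩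

/-- The symbol for a binary digit. -/
def digit : Bool → Γ'
  | false => .bit0
  | true => .bit1

/-- The machine stores the lowest digit on top, so extending the prefix by a bit is a single push.
The leading `1` of `prefixNumber` keeps `n` nonzero. -/
theorem trNat_bit (b : Bool) {n : ℕ} (hn : n ≠ 0) : trNat (Nat.bit b n) = digit b :: trNat n := by
  have hpos : ((n : ℕ) : Num) ≠ 0 := by simpa using hn
  rw [trNat, trNat]
  have h : ((Nat.bit b n : ℕ) : Num) = (if b then Num.bit1 (n : Num) else Num.bit0 (n : Num)) := by
    rw [Nat.bit_val, two_mul]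
    cases b
    · simp [Num.bit0_of_bit0]
    · simp [Num.bit1_of_bit1]
  rcases hx : (n : Num) with _ | m
  · exact absurd hx hpos
  · rw [h, hx]
    cases b <;> rfl

theorem trNat_one : trNat 1 = [Γ'.bit1] := by
  rw [trNat, Nat.cast_one]
  rfl

/-- A code for a total function reaches its value after a well-defined number of steps. -/
theorem exists_time_of_eval_eq {c : Code} {x y : List ℕ} (h : c.eval x = pure y) :
    ∃ n, (∀ m < n, ((next tr)^[m] ⟨some (trNormal c .halt), none,
        K'.elim (trList x) [] [] []⟩).l ≠ none) ∧
      (next tr)^[n] ⟨some (trNormal c .halt), none, K'.elim (trList x) [] [] []⟩ =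
        ⟨none, none, K'.elim (trList y) [] [] []⟩ := by
  have hreach : ∀ {a b : TM2.Cfg (fun _ : K' => Γ') Λ' (Option Γ')},
      StateTransition.Reaches (step tr) a b → ∃ n, (next tr)^[n] a = b := by
    intro a b hab
    induction hab using Relation.ReflTransGen.head_induction_on with
    | refl => exact ⟨0, rfl⟩
    | @head a a' hstep _ ih =>
      obtain ⟨n, hn⟩ := ih
      have hnext : next tr a = a' := congrArg (Option.getD · a) (Option.mem_def.1 hstep)
      exact ⟨n + 1, by rw [Function.iterate_succ_apply, hnext, hn]⟩
  have hmem : PartrecToTM2.halt y ∈ StateTransition.eval (step tr)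
      ⟨some (trNormal c .halt), none, K'.elim (trList x) [] [] []⟩ := by
    refine (tr_eval c x).symm ▸ ?_
    rw [h]
    exact Part.mem_map _ (Part.mem_some y)
  obtain ⟨n, hn⟩ := hreach (StateTransition.mem_eval.1 hmem).1
  change (next tr)^[n] ⟨some (trNormal c .halt), none, K'.elim (trList x) [] [] []⟩ =
    ⟨none, none, K'.elim (trList y) [] [] []⟩ at hn
  -- The least halting time is used, because the process leaves the evaluation at its first halt.
  have hex : ∃ n, ((next tr)^[n] ⟨some (trNormal c .halt), none,
      K'.elim (trList x) [] [] []⟩).l = none := ⟨n, by rw [hn]⟩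
  classical
  refine ⟨Nat.find hex, fun m hm => Nat.find_min hex hm, ?_⟩
  rw [← hn]
  exact (iterate_next_of_le rfl (Nat.find_spec hex) (Nat.find_min' hex (by rw [hn]))).symm

end PartrecToTM2

namespace PrefixRunner

/-- The control labels of the prefix process. -/
inductive Ctl
  | enter
  | post
  | yes
  | read

instance : Fintype Ctl :=
  ⟨⟨{.enter, .post, .yes, .read}, by simp⟩, fun a => by cases a <;> simp⟩

/-- Execute a statement of the evaluation machine, with one more stack. -/
def embed : Stmt (fun _ : K' => Γ') Λ' (Option Γ') →
    Stmt (fun _ : Option K' => Γ') (Λ' ⊕ Ctl) (Option Γ')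
  | push k f q => push (some k) f (embed q)
  | peek k f q => peek (some k) f (embed q)
  | pop k f q => pop (some k) f (embed q)
  | load f q => load f (embed q)
  | branch f q₁ q₂ => branch f (embed q₁) (embed q₂)
  | goto f => goto fun v => .inl (f v)
  | .halt => goto fun _ => .inr .post

/-- The machine which reads its input bit by bit, evaluates `c` on the prefixes of the input one
after the other, and passes through the label `yes` whenever the value is `1`. -/
def process (c : Code) : Λ' ⊕ Ctl → Stmt (fun _ : Option K' => Γ') (Λ' ⊕ Ctl) (Option Γ')
  | .inl q => embed (tr q)
  | .inr .enter => push (some .main) (fun _ => .cons) <| push (some .main) (fun _ => .bit1) <|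
      load (fun _ => none) <| goto fun _ => .inl (trNormal c .halt)
  | .inr .post => pop (some .main) (fun _ o => o) <| branch (fun o => decide (o = some .bit1))
      (goto fun _ => .inr .yes) (goto fun _ => .inr .read)
  | .inr .yes => pop (some .main) (fun _ o => o) <| goto fun _ => .inr .read
  | .inr .read => pop none (fun _ o => o) <| push (some .main) (fun o => o.getD default) <|
      load (fun _ => none) <| goto fun _ => .inl (trNormal c .halt)

/-- The labels which the process uses. -/
def support (c : Code) : Finset (Λ' ⊕ Ctl) :=
  (codeSupp c .halt).disjSum Finset.univ

theorem supportsStmt_embed {s : Finset Λ'} {q : Stmt (fun _ : K' => Γ') Λ' (Option Γ')}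
    (h : SupportsStmt s q) : SupportsStmt (s.disjSum (Finset.univ : Finset Ctl)) (embed q) := by
  induction q with
  | branch f q₁ q₂ ih₁ ih₂ => exact ⟨ih₁ h.1, ih₂ h.2⟩
  | goto f => exact fun v => Finset.inl_mem_disjSum.2 (h v)
  | halt => exact fun v => Finset.inr_mem_disjSum.2 (Finset.mem_univ _)
  | push _ _ _ ih => exact ih h
  | peek _ _ _ ih => exact ih h
  | pop _ _ _ ih => exact ih h
  | load _ _ ih => exact ih h

theorem supportsStmt_process (c : Code) :
    ∀ q ∈ support c, SupportsStmt (support c) (process c q) := by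
  have hstart : Sum.inl (trNormal c .halt) ∈ support c :=
    Finset.inl_mem_disjSum.2 (tr_supports c .halt).1
  have hctl : ∀ x : Ctl, Sum.inr x ∈ support c := fun x =>
    Finset.inr_mem_disjSum.2 (Finset.mem_univ x)
  rintro (q | (_ | _ | _ | _)) hq
  · exact supportsStmt_embed ((tr_supports c .halt).2 q (Finset.inl_mem_disjSum.1 hq))
  · exact fun _ => hstart
  · exact ⟨fun _ => hctl _, fun _ => hctl _⟩
  · exact fun _ => hctl _
  · exact fun _ => hstart

/-- The stacks of the process. -/
def joinStacks (S : K' → List Γ') (x : List Γ') : Option K' → List Γ'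
  | none => x
  | some k => S k

theorem update_joinStacks_some (S : K' → List Γ') (x : List Γ') (k : K') (y : List Γ') :
    Function.update (joinStacks S x) (some k) y = joinStacks (Function.update S k y) x := by
  funext j
  rcases j with _ | j
  · rfl
  · rcases eq_or_ne j k with rfl | h
    · simp [joinStacks]
    · simp [joinStacks, h]

theorem update_joinStacks_none (S : K' → List Γ') (x y : List Γ') :
    Function.update (joinStacks S x) none y = joinStacks S y := by
  funext j
  rcases j with _ | j <;> rfl

/-- The configuration of the process for a configuration of the evaluation machine. -/
def embedCfg (a : TM2.Cfg (fun _ : K' => Γ') Λ' (Option Γ')) (x : List Γ') :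
    TM2.Cfg (fun _ : Option K' => Γ') (Λ' ⊕ Ctl) (Option Γ') :=
  ⟨some (a.l.elim (.inr .post) .inl), a.var, joinStacks a.stk x⟩

theorem stepAux_embed (q : Stmt (fun _ : K' => Γ') Λ' (Option Γ')) (v : Option Γ')
    (S : K' → List Γ') (x : List Γ') :
    stepAux (embed q) v (joinStacks S x) = embedCfg (stepAux q v S) x := by
  induction q generalizing v S with
  | push k f q ih => rw [embed, stepAux, update_joinStacks_some, ih]; rfl
  | peek k f q ih => rw [embed, stepAux, ih]; rfl
  | pop k f q ih => rw [embed, stepAux, update_joinStacks_some, ih]; rfl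
  | load f q ih => rw [embed, stepAux, ih]; rfl
  | branch f q₁ q₂ ih₁ ih₂ =>
    rw [embed, stepAux, ih₁, ih₂, stepAux]
    cases f v <;> rfl
  | goto f => rfl
  | halt => rfl

variable (c : Code)

theorem iterate_next_embedCfg {n : ℕ} {a : TM2.Cfg (fun _ : K' => Γ') Λ' (Option Γ')}
    (h : ∀ m < n, ((next tr)^[m] a).l ≠ none) (x : List Γ') :
    (next (process c))^[n] (embedCfg a x) = embedCfg ((next tr)^[n] a) x := by
  induction n with
  | zero => rfl
  | succ n ih =>
    rw [Function.iterate_succ_apply', ih fun m hm => h m (by omega), Function.iterate_succ_apply']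
    have hn := h n (Nat.lt_succ_self n)
    generalize (next tr)^[n] a = a' at hn
    rcases a' with ⟨_ | q, v, S⟩
    · exact absurd rfl hn
    · exact stepAux_embed (tr q) v S x

/-- The configuration in which the process starts to treat the prefix `v`. -/
def stage (v : List Bool) (x : List Γ') :
    TM2.Cfg (fun _ : Option K' => Γ') (Λ' ⊕ Ctl) (Option Γ') :=
  ⟨some (.inl (trNormal c .halt)), none,
    joinStacks (K'.elim (trList [prefixNumber v]) [] [] []) x⟩

/-- Whether a label is the one of acceptance. -/
def isYes : Option (Λ' ⊕ Ctl) → Bool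
  | some (.inr .yes) => true
  | _ => false

theorem next_init (x : List Γ') :
    next (process c) ⟨some (.inr .enter), none, joinStacks (fun _ => []) x⟩ = stage c [] x := by
  rw [next_some, process, stepAux, update_joinStacks_some, stepAux, update_joinStacks_some]
  simp only [stepAux, stage]
  congr 2
  funext k
  cases k <;> simp [joinStacks, prefixNumber, trNat_one]

theorem next_read (v : List Bool) (b : Bool) (o : Option Γ') (x : List Γ') :
    next (process c) ⟨some (.inr .read), o,
      joinStacks (K'.elim (trList [prefixNumber v]) [] [] []) (digit b :: x)⟩ =
      stage c (v ++ [b]) x := by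
  have hpos : prefixNumber v ≠ 0 := (Nat.zero_lt_of_lt (length_lt_prefixNumber v)).ne'
  rw [next_some, process, stepAux, update_joinStacks_none, stepAux, update_joinStacks_some]
  simp only [stepAux, stage]
  congr 2
  funext k
  cases k <;> simp [joinStacks, prefixNumber_concat, trNat_bit b hpos]

/-- The evaluation machine for `c` decides `L v` in `s v` steps, preserving its input. -/
def DecidesPrefixesIn (L : List Bool → Bool) (s : List Bool → ℕ) : Prop :=
  ∀ v, (∀ m < s v, ((next tr)^[m] ⟨some (trNormal c .halt), none,
      K'.elim (trList [prefixNumber v]) [] [] []⟩).l ≠ none) ∧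
    (next tr)^[s v] ⟨some (trNormal c .halt), none, K'.elim (trList [prefixNumber v]) [] [] []⟩ =
      ⟨none, none, K'.elim (trList [(L v).toNat, prefixNumber v]) [] [] []⟩

section Stage

variable {c} {L : List Bool → Bool} {s : List Bool → ℕ}

theorem iterate_stage_post (hs : DecidesPrefixesIn c L s) (v : List Bool) (x : List Γ') :
    (next (process c))^[s v] (stage c v x) = ⟨some (.inr .post), none,
      joinStacks (K'.elim (trList [(L v).toNat, prefixNumber v]) [] [] []) x⟩ := by
  have := iterate_next_embedCfg c (hs v).1 x
  rw [(hs v).2] at this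
  exact this

theorem iterate_stage_of_true (hs : DecidesPrefixesIn c L s) {v : List Bool} (hv : L v = true)
    (x : List Γ') :
    (next (process c))^[s v + 1] (stage c v x) = ⟨some (.inr .yes), some .bit1,
      joinStacks (K'.elim (.cons :: trList [prefixNumber v]) [] [] []) x⟩ := by
  rw [Function.iterate_succ_apply', iterate_stage_post hs, hv, next_some, process, stepAux,
    update_joinStacks_some]
  simp [joinStacks, trNat_one]

theorem iterate_stage_read (hs : DecidesPrefixesIn c L s) (v : List Bool) (x : List Γ') :
    ∃ o, (next (process c))^[s v + 1 + (L v).toNat] (stage c v x) = ⟨some (.inr .read), o,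
      joinStacks (K'.elim (trList [prefixNumber v]) [] [] []) x⟩ := by
  rcases hv : L v
  · refine ⟨some .cons, ?_⟩
    rw [Bool.toNat_false, add_zero, Function.iterate_succ_apply', iterate_stage_post hs, hv,
      next_some, process, stepAux, update_joinStacks_some]
    simp [joinStacks]
  · refine ⟨some .cons, ?_⟩
    rw [Bool.toNat_true, Function.iterate_succ_apply', iterate_stage_of_true hs hv,
      next_some, process, stepAux, update_joinStacks_some]
    simp [joinStacks]

theorem iterate_stage_next (hs : DecidesPrefixesIn c L s) (v : List Bool) (b : Bool) (x : List Γ') :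
    (next (process c))^[s v + 2 + (L v).toNat] (stage c v (digit b :: x)) =
      stage c (v ++ [b]) x := by
  obtain ⟨o, ho⟩ := iterate_stage_read hs v (digit b :: x)
  rw [show s v + 2 + (L v).toNat = s v + 1 + (L v).toNat + 1 by omega,
    Function.iterate_succ_apply', ho, next_read]

/-- Labels of the evaluation are never `yes`. A stage ends with `post`, then `yes` if the prefix is
accepted, then `read`; so acceptance shows once, just after `post`. -/
theorem isYes_iterate_stage (hs : DecidesPrefixesIn c L s) (v : List Bool) (x : List Γ') {t : ℕ}
    (ht : t < s v + 2 + (L v).toNat) :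
    isYes ((next (process c))^[t] (stage c v x)).l = true ↔ L v = true ∧ t = s v + 1 := by
  rcases lt_trichotomy t (s v) with hlt | rfl | hgt
  · have h : (next (process c))^[t] (stage c v x) = _ :=
      iterate_next_embedCfg c (fun m hm => (hs v).1 m (hm.trans hlt)) x
    have hne := (hs v).1 t hlt
    rw [h]
    generalize (next tr)^[t] _ = a at hne
    rcases a with ⟨_ | q, y, S⟩
    · exact absurd rfl hne
    · simp only [embedCfg, Option.elim, isYes]
      constructor
      · intro h; cases h
      · rintro ⟨-, h⟩; omega
  · rw [iterate_stage_post hs]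
    simp [isYes]
  · rcases hv : L v
    · rw [hv, Bool.toNat_false] at ht
      obtain ⟨o, ho⟩ := iterate_stage_read hs v x
      rw [hv, Bool.toNat_false] at ho
      rw [show t = s v + 1 + 0 by omega, ho]
      simp [isYes]
    · rw [hv, Bool.toNat_true] at ht
      rcases (show t = s v + 1 ∨ t = s v + 1 + 1 by omega) with rfl | rfl
      · rw [iterate_stage_of_true hs hv]
        simp [isYes]
      · obtain ⟨o, ho⟩ := iterate_stage_read hs v x
        rw [hv, Bool.toNat_true] at ho
        rw [ho]
        simp [isYes]

end Stage

end PrefixRunner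

end Turing

/-! ### The delayed learner. -/

namespace Turing.PrefixRunner

open PartrecToTM2 ToPartrec TM2

/-- The learning function which runs the process for as many steps as its input is long. -/
def delayedLearner (c : Code) : LearningFunction := fun w =>
  isYes ((next (process c))^[w.length] ⟨some (.inr .enter), none,
    Function.update (fun _ => []) none (w.map digit)⟩).l

theorem polyTimeComputable_delayedLearner (c : Code) : PolyTimeComputable (delayedLearner c) :=
  polyTimeComputable_label_iterate_next (process c) (support c) (supportsStmt_process c)
    (.inr .enter) (Finset.inr_mem_disjSum.2 (Finset.mem_univ _)) none none digit isYes

/-- The time at which the process starts to treat the `m`-th prefix of `Y`. -/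
def stageTime (L : List Bool → Bool) (s : List Bool → ℕ) (Y : Cantor) : ℕ → ℕ
  | 0 => 1
  | m + 1 => stageTime L s Y m + (s (Y.take m) + 2 + (L (Y.take m)).toNat)

/-- The time at which the process accepts the `m`-th prefix of `Y`, if it does. -/
def yesTime (L : List Bool → Bool) (s : List Bool → ℕ) (Y : Cantor) (m : ℕ) : ℕ :=
  stageTime L s Y m + (s (Y.take m) + 1)

variable {c : Code} {L : List Bool → Bool} {s : List Bool → ℕ}

theorem lt_stageTime (L : List Bool → Bool) (s : List Bool → ℕ) (Y : Cantor) (m : ℕ) :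
    m < stageTime L s Y m := by
  induction m with
  | zero => exact Nat.one_pos
  | succ m ih => rw [stageTime]; omega

theorem strictMono_yesTime (L : List Bool → Bool) (s : List Bool → ℕ) (Y : Cantor) :
    StrictMono (yesTime L s Y) :=
  strictMono_nat_of_lt_succ fun m => by
    rw [yesTime, yesTime, stageTime]
    omega

theorem exists_stageTime_le_lt (L : List Bool → Bool) (s : List Bool → ℕ) (Y : Cantor) {p : ℕ}
    (hp : p ≠ 0) : ∃ m, stageTime L s Y m ≤ p ∧ p < stageTime L s Y (m + 1) := by
  have hex : ∃ m, p < stageTime L s Y m := ⟨p, lt_stageTime L s Y p⟩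
  rcases hm : Nat.find hex with _ | m
  · have := Nat.find_spec hex
    rw [hm, stageTime] at this
    omega
  · exact ⟨m, not_lt.1 (Nat.find_min hex (by omega)), hm ▸ Nat.find_spec hex⟩

theorem iterate_next_stageTime (hs : DecidesPrefixesIn c L s) (Y : Cantor) {m p : ℕ} (h : m ≤ p) :
    (next (process c))^[stageTime L s Y m] ⟨some (.inr .enter), none,
      Function.update (fun _ => []) none ((Y.take p).map digit)⟩ =
      stage c (Y.take m) (((Y.take p).drop m).map digit) := by
  induction m with
  | zero =>
    have : Function.update (fun _ => []) none ((Y.take p).map digit) =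
        joinStacks (fun _ => []) ((Y.take p).map digit) := by
      funext k
      cases k <;> rfl
    rw [this]
    exact next_init c _
  | succ m ih =>
    have hdrop : (Y.take p).drop m = Y m :: (Y.take p).drop (m + 1) := by
      rw [List.drop_eq_getElem_cons (by rw [Cantor.length_take]; omega)]
      simp [Cantor.take]
    rw [stageTime, add_comm, Function.iterate_add_apply, ih (by omega), hdrop, List.map_cons,
      iterate_stage_next hs, ← Y.take_succ]

/-- Since `m < stageTime L s Y m ≤ p`, the `p` available bits include the `m` bits read before this
stage. The next bit is read only in the step that ends the stage, so the finite input does not run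
out. -/
theorem delayedLearner_take_eq_true_iff (hs : DecidesPrefixesIn c L s) (Y : Cantor) {m p : ℕ}
    (h₁ : stageTime L s Y m ≤ p) (h₂ : p < stageTime L s Y (m + 1)) :
    delayedLearner c (Y.take p) = true ↔ L (Y.take m) = true ∧ p = yesTime L s Y m := by
  obtain ⟨d, rfl⟩ := Nat.exists_eq_add_of_le' h₁
  have hm := lt_stageTime L s Y m
  rw [delayedLearner, Cantor.length_take, Function.iterate_add_apply,
    iterate_next_stageTime hs Y (by omega : m ≤ d + stageTime L s Y m),
    isYes_iterate_stage hs _ _ (by rw [stageTime] at h₂; omega), yesTime]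
  exact and_congr_right fun _ => by omega

theorem setOf_delayedLearner (hs : DecidesPrefixesIn c L s) (Y : Cantor) :
    {p : ℕ | delayedLearner c (Y.take p) = true} =
      yesTime L s Y '' {m : ℕ | L (Y.take m) = true} := by
  ext p
  constructor
  · intro hp
    -- Time `0` precedes all stages; the label is then `enter`.
    have hp0 : p ≠ 0 := by
      rintro rfl
      cases hp
    obtain ⟨m, h₁, h₂⟩ := exists_stageTime_le_lt L s Y hp0
    obtain ⟨hL, hm⟩ := (delayedLearner_take_eq_true_iff hs Y h₁ h₂).1 hp
    exact ⟨m, hL, hm.symm⟩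
  · rintro ⟨m, hm, rfl⟩
    refine (delayedLearner_take_eq_true_iff hs Y ?_ ?_).2 ⟨hm, rfl⟩
    · rw [yesTime]; omega
    · rw [yesTime, stageTime]; omega

theorem uniformlyWeaklyDetects_delayedLearner (hs : DecidesPrefixesIn c L s) {X : Cantor}
    (h : UniformlyWeaklyDetects L X) : UniformlyWeaklyDetects (delayedLearner c) X := by
  refine ⟨?_, fun n => ?_⟩
  · rw [setOf_delayedLearner hs]
    exact h.1.image (strictMono_yesTime L s X).injective.injOn
  · have : ∀ Y : Cantor, {p : ℕ | delayedLearner c (Y.take p) = true}.encard =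
        {m : ℕ | L (Y.take m) = true}.encard := fun Y => by
      rw [setOf_delayedLearner hs, (strictMono_yesTime L s Y).injective.encard_image]
    simp_rw [this]
    exact h.2 n

theorem exists_decidesPrefixesIn (hL : Computable L) : ∃ c s, DecidesPrefixesIn c L s := by
  let f : ℕ → ℕ := fun n => (L (prefixOfNumber n)).toNat
  have hf : Computable f := (Primrec.dom_bool Bool.toNat).to_comp.comp
    (hL.comp primrec_prefixOfNumber.to_comp)
  obtain ⟨c₀, hc₀⟩ := Code.exists_code (Nat.Partrec'.part_iff₁.2 hf)
  -- Consing with `Code.id` keeps the prefix number below the answer, ready to be extended by the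
  -- next bit.
  have hc : ∀ v, (Code.cons c₀ Code.id).eval [prefixNumber v] =
      pure [(L v).toNat, prefixNumber v] := by
    intro v
    have h : c₀.eval [prefixNumber v] = Part.some [f (prefixNumber v)] := by
      rw [hc₀ ⟨[prefixNumber v], rfl⟩]
      exact Part.map_some _ _
    have hv : f (prefixNumber v) = (L v).toNat := by
      simp only [f, prefixOfNumber_prefixNumber]
    simp [h, hv]
  choose s hs using fun v => exists_time_of_eval_eq (hc v)
  exact ⟨_, s, hs⟩

end Turing.PrefixRunner

/-- Every sequence detected by a computable learning function is detected by a polynomial time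
computable one. -/
theorem exists_polyTimeComputable_of_computable {L : LearningFunction} (hL : Computable L)
    {X : Cantor} (h : UniformlyWeaklyDetects L X) :
    ∃ l : LearningFunction, PolyTimeComputable l ∧ UniformlyWeaklyDetects l X := by
  obtain ⟨c, s, hs⟩ := Turing.PrefixRunner.exists_decidesPrefixesIn hL
  exact ⟨_, Turing.PrefixRunner.polyTimeComputable_delayedLearner c,
    Turing.PrefixRunner.uniformlyWeaklyDetects_delayedLearner hs h⟩

theorem mainTheorem6 (X : Cantor) :
    MartinLofRandom X ↔
      ¬ ∃ l : LearningFunction, PolyTimeComputable l ∧ UniformlyWeaklyDetects l X := by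
  refine not_congr ⟨?_, ?_⟩
  · rintro ⟨g, hg, h⟩
    exact exists_polyTimeComputable_of_computable (computable_testLearner hg)
      (uniformlyWeaklyDetects_testLearner (fun k => Set.singleton_subset_iff.1 (h k).1)
        fun k => (h k).2)
  · rintro ⟨l, hl, h⟩
    exact h.algorithmicMeasureZero hl.primrec
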